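/- Let $(X,\mathrm{dist})$ be a locally compact separable metric space with a Radon measure $\mu$, write $|B|=\mu(B)$, and suppose that for some $D>0$ the doubling condition $0<|B(x,2r)|\le 2^{D}|B(x,r)|$ holds for all open balls. Let $\mathcal L$ be a non-negative self-adjoint operator in the real space $L_2(X,\mu)$ with non-negative square root $\mathcal L^{1/2}$, such that the form $\mathcal E(f,g)=\langle \mathcal L^{1/2}f,\mathcal L^{1/2}g\rangle$ with domain $\mathcal D(\mathcal E)=\mathcal D(\mathcal L^{1/2})$ is a strongly local regular Dirichlet form. For $f\in\mathcal D(\mathcal E)$ let $d\Gamma(f,f)$ be its energy measure: for bounded $f$ it is the finite Borel measure with $\int\varphi\,d\Gamma(f,f)=\mathcal E(f,f\varphi)-\tfrac12\mathcal E(f^2,\varphi)$ for all $\varphi\in\mathcal D(\mathcal E)\cap C_c(X)$, and in general it is the setwise limit of the energy measures of the truncations $\max(-n,\min(f,n))$, $n\to\infty$. Suppose that there are constants $C>0$ and $r_0>0$ such that the local Poincaré inequality $$\int_{B(x,r)}|f-f_{B}|^2\,d\mu\le C r^2\int_{B(x,r)}d\Gamma(f,f),\qquad f_B=\frac1{|B(x,r)|}\int_{B(x,r)}f\,d\mu,$$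 holds for all $f\in\mathcal D(\mathcal L)$, $x\in X$ and $0<r<r_0$. For $\rho>0$ and $N\in\mathbb N$ call a set $\{x_j\}\subset X$ a $\rho$-lattice of multiplicity at most $N$ if the balls $B(x_j,\rho/2)$ are pairwise disjoint, the balls $B(x_j,\rho)$ cover $X$, and no point of $X$ lies in more than $N$ of the balls $B(x_j,\rho)$. Put $\xi_j=|B(x_j,\rho)|^{-1/2}\chi_{B(x_j,\rho)}$. Then there is a natural number $N\le 80^{D}$ such that for every $\rho>0$ there exists a $\rho$-lattice of multiplicity at most $N$. Moreover, for every $N\in\mathbb N$, every $0<\rho<r_0$, every $\rho$-lattice $\{x_j\}$ of multiplicity at most $N$, every $f\in\mathcal D(\mathcal L^{1/2})$ and every $\alpha>0$, the series $\sum_j|\langle f,\xi_j\rangle|^2$ converges and $$\|f\|^2\le(1+\alpha)\,C\,N\,\rho^2\,\|\mathcal L^{1/2}f\|^2+\frac{1+\alpha}{\alpha}\sum_j|\langle f,\xi_j\rangle|^2 .$$ -/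

import Mathlib

open MeasureTheory Metric Filter Topology
open scoped ENNReal

noncomputable section

namespace GlobalPoincare

section SquareRoot

variable {H : Type*} [NormedAddCommGroup H] [InnerProductSpace ℝ H] [CompleteSpace H]

/-- A partially defined operator is non-negative if `⟨A f, f⟩ ≥ 0` on its domain. -/
def IsNonneg (A : H →ₗ.[ℝ] H) : Prop :=
  ∀ f : A.domain, 0 ≤ inner ℝ (A f) (f : H)

/-- `S` is a non-negative self-adjoint operator with `S ∘ S = A`, where the composition has
its natural domain `{f ∈ D(S) | S f ∈ D(S)}`. -/
structure IsNonnegSqrt (A S : H →ₗ.[ℝ] H) : Prop where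
  selfAdjoint : IsSelfAdjoint S
  nonneg : IsNonneg S
  square : ∀ f h : H, (f, h) ∈ A.graph ↔ ∃ g : H, (f, g) ∈ S.graph ∧ (g, h) ∈ S.graph

open scoped Classical in
/-- The non-negative square root `A^{1/2}` of a non-negative self-adjoint operator `A`
(which exists and is unique for such `A`; a default value otherwise). -/
def sqrtOp (A : H →ₗ.[ℝ] H) : H →ₗ.[ℝ] H :=
  if h : ∃ S : H →ₗ.[ℝ] H, IsNonnegSqrt A S then h.choose else 0

end SquareRoot

section Spaces

variable {X : Type*} [MetricSpace X] [MeasurableSpace X]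

/-- The doubling condition `0 < |B(x, 2r)| ≤ 2^D |B(x, r)|`. -/
def IsDoubling (μ : Measure X) (D : ℝ) : Prop :=
  ∀ (x : X) (r : ℝ), 0 < r →
    0 < μ (ball x (2 * r)) ∧ μ (ball x (2 * r)) ≤ (2 : ℝ≥0∞) ^ D * μ (ball x r)

/-- A metric `ρ`-lattice with multiplicity constant `N`: the balls of radius `ρ / 2` are disjoint,
the balls of radius `ρ` cover `X`, and no point lies in more than `N` of the latter. -/
structure IsLattice (N : ℕ) (ρ : ℝ) (Λ : Set X) : Prop where
  disjoint : Λ.PairwiseDisjoint fun p => ball p (ρ / 2)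
  cover : ⋃ p ∈ Λ, ball p ρ = Set.univ
  multiplicity : ∀ x : X, {p ∈ Λ | x ∈ ball p ρ}.encard ≤ N

/-- The function `ξ = |B(p, ρ)|^{-1/2} χ_{B(p, ρ)}`. -/
def xi (μ : Measure X) (ρ : ℝ) (p : X) : X → ℝ :=
  (ball p ρ).indicator fun _ => (μ.real (ball p ρ)) ^ (-(1 / 2) : ℝ)

variable {μ : Measure X}

/-- The bilinear form `E(f, g) = ⟨L^{1/2} f, L^{1/2} g⟩` associated with `L`,
with domain `D(E) = D(L^{1/2})`. -/
def form (L : Lp ℝ 2 μ →ₗ.[ℝ] Lp ℝ 2 μ) (f g : (sqrtOp L).domain) : ℝ :=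
  inner ℝ (sqrtOp L f) (sqrtOp L g)

/-- The form of `L` is a Dirichlet form: the unit contraction operates on it. (Being the form of
a non-negative self-adjoint operator, it is densely defined, symmetric, non-negative and
closed.) -/
def IsDirichlet (L : Lp ℝ 2 μ →ₗ.[ℝ] Lp ℝ 2 μ) : Prop :=
  ∀ f : (sqrtOp L).domain, ∃ g : (sqrtOp L).domain,
    ((g : Lp ℝ 2 μ) =ᵐ[μ] fun x => max 0 (min ((f : Lp ℝ 2 μ) x) 1)) ∧ form L g g ≤ form L f f

/-- Regularity: `D(E) ∩ C_c(X)` is dense in `D(E)` for the norm `(‖f‖² + E(f, f))^{1/2}` and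
dense in `C_c(X)` for the uniform norm. -/
structure IsRegular (L : Lp ℝ 2 μ →ₗ.[ℝ] Lp ℝ 2 μ) : Prop where
  dense_domain : ∀ f : (sqrtOp L).domain, ∀ ε > 0,
    ∃ (φ : X → ℝ) (g : (sqrtOp L).domain), Continuous φ ∧ HasCompactSupport φ ∧
      ((g : Lp ℝ 2 μ) =ᵐ[μ] φ) ∧
      ‖(f : Lp ℝ 2 μ) - g‖ ^ 2 + form L (f - g) (f - g) < ε
  dense_continuous : ∀ ψ : X → ℝ, Continuous ψ → HasCompactSupport ψ → ∀ ε > 0,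
    ∃ (φ : X → ℝ) (g : (sqrtOp L).domain), Continuous φ ∧ HasCompactSupport φ ∧
      ((g : Lp ℝ 2 μ) =ᵐ[μ] φ) ∧ ∀ x, |ψ x - φ x| < ε

/-- Strong locality: `E(f, g) = 0` whenever `f, g ∈ D(E)` have compact support and `g` is constant
on a neighbourhood `U` of the support of `f`. -/
def IsStronglyLocal (L : Lp ℝ 2 μ →ₗ.[ℝ] Lp ℝ 2 μ) : Prop :=
  ∀ (f g : (sqrtOp L).domain) (K K' U : Set X) (c : ℝ),
    IsCompact K → IsCompact K' → IsOpen U → K ⊆ U →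
    (∀ᵐ x ∂μ, x ∉ K → (f : Lp ℝ 2 μ) x = 0) →
    (∀ᵐ x ∂μ, x ∉ K' → (g : Lp ℝ 2 μ) x = 0) →
    (∀ᵐ x ∂μ, x ∈ U → (g : Lp ℝ 2 μ) x = c) →
    form L f g = 0

/-- `m` is the energy measure `dΓ(f, f)` of a bounded `f ∈ D(E)`: the finite Borel measure with
`∫ φ dΓ(f, f) = E(f, fφ) - (1/2) E(f², φ)` for all `φ ∈ D(E) ∩ C_c(X)`. (Products of bounded
functions in the domain of a Dirichlet form are again in the domain.) -/
def IsBddEnergyMeasure (L : Lp ℝ 2 μ →ₗ.[ℝ] Lp ℝ 2 μ) (f : (sqrtOp L).domain)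
    (m : Measure X) : Prop :=
  IsFiniteMeasure m ∧
    ∀ (φ : X → ℝ) (p : (sqrtOp L).domain), Continuous φ → HasCompactSupport φ →
      ((p : Lp ℝ 2 μ) =ᵐ[μ] φ) →
      ∃ u v : (sqrtOp L).domain,
        ((u : Lp ℝ 2 μ) =ᵐ[μ] fun x => (f : Lp ℝ 2 μ) x * φ x) ∧
        ((v : Lp ℝ 2 μ) =ᵐ[μ] fun x => ((f : Lp ℝ 2 μ) x) ^ 2) ∧
        ∫ x, φ x ∂m = form L f u - (1 / 2) * form L v p

/-- `m` is the energy measure `dΓ(f, f)` of `f ∈ D(E)`: the finite Borel measure which is the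
setwise limit of the energy measures of the truncations `(-n) ∨ (f ∧ n)`. -/
def IsEnergyMeasure (L : Lp ℝ 2 μ →ₗ.[ℝ] Lp ℝ 2 μ) (f : Lp ℝ 2 μ) (m : Measure X) : Prop :=
  f ∈ (sqrtOp L).domain ∧ IsFiniteMeasure m ∧
    ∃ (g : ℕ → (sqrtOp L).domain) (ν : ℕ → Measure X),
      (∀ n : ℕ, ((g n : Lp ℝ 2 μ) =ᵐ[μ] fun x => max (-(n : ℝ)) (min (f x) n)) ∧
        IsBddEnergyMeasure L (g n) (ν n)) ∧
      ∀ A : Set X, MeasurableSet A → Tendsto (fun n => ν n A) atTop (𝓝 (m A))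

open scoped Classical in
/-- The energy measure `dΓ(f, f)` of `f ∈ D(E)` (it exists and is unique if `E` is a regular
Dirichlet form; a default value otherwise). -/
def energyMeasure (L : Lp ℝ 2 μ →ₗ.[ℝ] Lp ℝ 2 μ) (f : Lp ℝ 2 μ) : Measure X :=
  if h : ∃ m : Measure X, IsEnergyMeasure L f m then h.choose else 0

/-- The local Poincaré inequality with constant `C`, for all balls of radius less than `r₀` and
all `f ∈ D(L)`. -/
def LocalPoincare (L : Lp ℝ 2 μ →ₗ.[ℝ] Lp ℝ 2 μ) (C r₀ : ℝ) : Prop :=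
  ∀ f ∈ L.domain, ∀ (x : X) (r : ℝ), 0 < r → r < r₀ →
    ∫ y in ball x r, (f y - ⨍ z in ball x r, f z ∂μ) ^ 2 ∂μ ≤
      C * r ^ 2 * (energyMeasure L f).real (ball x r)

end Spaces

end GlobalPoincare

end

/-!
Summing the local Poincaré inequality over the balls `B(p, ρ)` of a lattice, whose overlap is at
most `N`, bounds `‖f‖²` by the squared coefficients plus `C N ρ²` times the total energy. The
total energy is at most `E(f, f)`: the form is the limit of the bounded forms `β ⟨f - J f, g⟩`,
where `J = β (β + L)⁻¹` is sub-Markovian, and for these the energy has the density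
`β ((f² + J f²) / 2 - f J f) ≥ 0`, whose integral is at most `β ⟨f - J f, f⟩` because `J` does not
increase integrals of non-negative functions. Bessel's inequality for the functions `ξ_p` makes
the sum of squared coefficients continuous on `L²`, so the inequality passes from the core `D(L)`
to `D(E)`. The lattice is a maximal set of centres with disjoint balls of radius `ρ / 2`, and
doubling bounds its overlap by comparing `B(p, ρ / 2)` with `B(x, 3 ρ / 2) ⊆ B(p, 4 ρ)`.
-/

namespace GlobalPoincare

section Lattice

variable {X : Type*} [MetricSpace X] [MeasurableSpace X] {μ : Measure X} {D ρ : ℝ}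

theorem IsDoubling.measure_ball_pos (h : IsDoubling μ D) (x : X) {r : ℝ} (hr : 0 < r) :
    0 < μ (ball x r) := by
  simpa only [mul_div_cancel₀ r two_ne_zero] using (h x (r / 2) (half_pos hr)).1

theorem IsDoubling.measure_ball_pow_mul_le (h : IsDoubling μ D) (x : X) {r : ℝ} (hr : 0 < r)
    (k : ℕ) : μ (ball x (2 ^ k * r)) ≤ ((2 : ℝ≥0∞) ^ D) ^ k * μ (ball x r) := by
  induction k with
  | zero => simp
  | succ k ih =>
    calc μ (ball x (2 ^ (k + 1) * r)) = μ (ball x (2 * (2 ^ k * r))) := by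
          rw [pow_succ', mul_assoc]
      _ ≤ (2 : ℝ≥0∞) ^ D * μ (ball x (2 ^ k * r)) := (h x _ (by positivity)).2
      _ ≤ (2 : ℝ≥0∞) ^ D * (((2 : ℝ≥0∞) ^ D) ^ k * μ (ball x r)) := by gcongr
      _ = ((2 : ℝ≥0∞) ^ D) ^ (k + 1) * μ (ball x r) := by rw [pow_succ', mul_assoc]

theorem IsDoubling.measure_ball_lt_top [IsLocallyFiniteMeasure μ] (h : IsDoubling μ D) (x : X)
    (r : ℝ) : μ (ball x r) < ∞ := by
  obtain ⟨s, hs, hs_fin⟩ := μ.finiteAt_nhds x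
  obtain ⟨δ, hδ, hδs⟩ := Metric.mem_nhds_iff.1 hs
  obtain ⟨k, hk⟩ := pow_unbounded_of_one_lt (r / δ) one_lt_two
  have h2D : (2 : ℝ≥0∞) ^ D < ∞ :=
    (ENNReal.rpow_ne_top_of_ne_zero two_ne_zero ENNReal.ofNat_ne_top).lt_top
  calc μ (ball x r) ≤ μ (ball x (2 ^ k * δ)) :=
        measure_mono (ball_subset_ball ((div_lt_iff₀ hδ).1 hk).le)
    _ ≤ ((2 : ℝ≥0∞) ^ D) ^ k * μ (ball x δ) := h.measure_ball_pow_mul_le x hδ k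
    _ < ∞ := ENNReal.mul_lt_top (ENNReal.pow_lt_top h2D) ((measure_mono hδs).trans_lt hs_fin)

theorem IsDoubling.measureReal_ball_pos [IsLocallyFiniteMeasure μ] (h : IsDoubling μ D) (x : X)
    {r : ℝ} (hr : 0 < r) : 0 < μ.real (ball x r) :=
  ENNReal.toReal_pos (h.measure_ball_pos x hr).ne' (h.measure_ball_lt_top x r).ne

theorem IsDoubling.measure_ball_le_of_dist_lt (h : IsDoubling μ D) {x p : X}
    (hxp : dist x p < ρ) : μ (ball x (3 / 2 * ρ)) ≤ 8 ^ D * μ (ball p (ρ / 2)) := by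
  have h8 : (8 : ℝ≥0∞) ^ D = ((2 : ℝ≥0∞) ^ D) ^ 3 := by
    rw [← ENNReal.rpow_mul_natCast, mul_comm, ENNReal.rpow_natCast_mul]
    norm_num
  calc μ (ball x (3 / 2 * ρ)) ≤ μ (ball p (2 ^ 3 * (ρ / 2))) :=
        measure_mono (ball_subset_ball' (by linarith [dist_nonneg (x := x) (y := p)]))
    _ ≤ ((2 : ℝ≥0∞) ^ D) ^ 3 * μ (ball p (ρ / 2)) :=
        h.measure_ball_pow_mul_le p (by linarith [dist_nonneg (x := x) (y := p)]) 3
    _ = 8 ^ D * μ (ball p (ρ / 2)) := by rw [h8]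

theorem IsDoubling.encard_le [OpensMeasurableSpace X] [IsLocallyFiniteMeasure μ]
    (h : IsDoubling μ D) (hρ : 0 < ρ) {Λ : Set X}
    (hΛ : Λ.PairwiseDisjoint fun p => ball p (ρ / 2)) (x : X) :
    {p ∈ Λ | x ∈ ball p ρ}.encard ≤ ⌊(8 : ℝ) ^ D⌋₊ := by
  set T := {p ∈ Λ | x ∈ ball p ρ}
  set V := μ (ball x (3 / 2 * ρ))
  have hdisj : Pairwise (Function.onFun Disjoint fun p : T => ball (p : X) (ρ / 2)) :=
    fun p q hpq => hΛ p.2.1 q.2.1 (Subtype.coe_ne_coe.2 hpq)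
  have hsub : ⋃ p : T, ball (p : X) (ρ / 2) ⊆ ball x (3 / 2 * ρ) :=
    Set.iUnion_subset fun p => ball_subset_ball' (by linarith [mem_ball'.1 p.2.2])
  have hmul : (T.encard : ℝ≥0∞) * V ≤ 8 ^ D * V :=
    calc (T.encard : ℝ≥0∞) * V = ∑' _ : T, V := (ENNReal.tsum_set_const T V).symm
      _ ≤ ∑' p : T, 8 ^ D * μ (ball p (ρ / 2)) :=
          ENNReal.tsum_le_tsum fun p => h.measure_ball_le_of_dist_lt (mem_ball.1 p.2.2)
      _ = 8 ^ D * ∑' p : T, μ (ball p (ρ / 2)) := ENNReal.tsum_mul_left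
      _ ≤ 8 ^ D * V := by
          gcongr
          exact (tsum_meas_le_meas_iUnion_of_disjoint μ (fun _ => measurableSet_ball) hdisj).trans
            (measure_mono hsub)
  have hle : (T.encard : ℝ≥0∞) ≤ 8 ^ D :=
    (ENNReal.mul_le_mul_iff_left (h.measure_ball_pos x (by positivity)).ne'
      (h.measure_ball_lt_top x _).ne).1 hmul
  have h8D : (8 : ℝ≥0∞) ^ D ≠ ∞ :=
    ENNReal.rpow_ne_top_of_ne_zero (by norm_num) ENNReal.ofNat_ne_top
  obtain ⟨n, hn⟩ : ∃ n : ℕ, T.encard = n :=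
    ENat.ne_top_iff_exists.1 (fun htop => (hle.trans_lt h8D.lt_top).ne (by simp [htop])) |>.imp
      fun _ => Eq.symm
  rw [hn] at hle ⊢
  have hreal : (n : ℝ) ≤ 8 ^ D := by
    simpa [← ENNReal.toReal_rpow] using ENNReal.toReal_mono h8D hle
  exact_mod_cast Nat.le_floor hreal

theorem exists_pairwiseDisjoint_ball_cover (X : Type*) [MetricSpace X] {ρ : ℝ} (hρ : 0 < ρ) :
    ∃ Λ : Set X, Λ.PairwiseDisjoint (fun p => ball p (ρ / 2)) ∧
      ⋃ p ∈ Λ, ball p ρ = Set.univ := by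
  obtain ⟨Λ, hΛ⟩ := zorn_subset {Λ : Set X | Λ.PairwiseDisjoint fun p => ball p (ρ / 2)}
    fun c hc hchain => ⟨⋃₀ c,
      (Set.pairwiseDisjoint_sUnion hchain.directedOn).2 fun s hs => hc hs,
      fun s hs => Set.subset_sUnion_of_mem hs⟩
  refine ⟨Λ, hΛ.prop, Set.eq_univ_of_forall fun x => ?_⟩
  by_contra hx
  simp only [Set.mem_iUnion, mem_ball, exists_prop, not_exists, not_and, not_lt] at hx
  have hinsert : (insert x Λ).PairwiseDisjoint fun p => ball p (ρ / 2) :=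
    hΛ.prop.insert fun p hp _ => ball_disjoint_ball (by linarith [hx p hp])
  have hxx := hx x (hΛ.le_of_ge hinsert (Set.subset_insert x Λ) (Set.mem_insert x Λ))
  rw [dist_self] at hxx
  exact hxx.not_gt hρ

theorem IsDoubling.exists_isLattice [OpensMeasurableSpace X] [IsLocallyFiniteMeasure μ]
    (h : IsDoubling μ D) (hρ : 0 < ρ) : ∃ Λ : Set X, IsLattice ⌊(8 : ℝ) ^ D⌋₊ ρ Λ := by
  obtain ⟨Λ, hdisj, hcover⟩ := exists_pairwiseDisjoint_ball_cover X hρ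
  exact ⟨Λ, hdisj, hcover, h.encard_le hρ hdisj⟩

end Lattice

section LatticeSums

variable {X : Type*} [MetricSpace X] {N : ℕ} {ρ : ℝ} {Λ : Set X}

theorem IsLattice.countable [TopologicalSpace.SeparableSpace X] (h : IsLattice N ρ Λ)
    (hρ : 0 < ρ) : Countable Λ :=
  (h.disjoint.countable_of_isOpen (fun _ _ => isOpen_ball)
    fun p _ => ⟨p, mem_ball_self (half_pos hρ)⟩).to_subtype

variable [MeasurableSpace X] {m : Measure X} {g : X → ℝ}

theorem IsLattice.le_sum_restrict [TopologicalSpace.SeparableSpace X] (h : IsLattice N ρ Λ)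
    (hρ : 0 < ρ) (m : Measure X) :
    m ≤ Measure.sum fun p : Λ => m.restrict (ball p ρ) := by
  have := h.countable hρ
  calc m = m.restrict (⋃ p : Λ, ball (p : X) ρ) := by
        rw [← Set.biUnion_eq_iUnion Λ fun p _ => ball p ρ, h.cover, Measure.restrict_univ]
    _ ≤ Measure.sum fun p : Λ => m.restrict (ball p ρ) := Measure.restrict_iUnion_le

variable [OpensMeasurableSpace X]

theorem IsLattice.sum_restrict_le (h : IsLattice N ρ Λ) (m : Measure X) :
    Measure.sum (fun p : Λ => m.restrict (ball p ρ)) ≤ (N : ℝ≥0∞) • m := by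
  have hmult : ∀ y, {p : Λ | y ∈ ball (p : X) ρ}.encard ≤ N := fun y => by
    rw [← Subtype.val_injective.encard_image]
    refine (Set.encard_le_encard ?_).trans (h.multiplicity y)
    rintro _ ⟨p, hp, rfl⟩
    exact ⟨p.2, hp⟩
  rw [Nat.cast_smul_eq_nsmul]
  refine (Measure.sum_restrict_le (fun _ => measurableSet_ball) hmult).trans ?_
  gcongr
  exact Measure.restrict_le_self

theorem IsLattice.integrable_sum_restrict (h : IsLattice N ρ Λ) (hg : Integrable g m) :
    Integrable g (Measure.sum fun p : Λ => m.restrict (ball p ρ)) :=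
  (hg.smul_measure (ENNReal.natCast_ne_top N)).mono_measure (h.sum_restrict_le m)

variable [TopologicalSpace.SeparableSpace X]

theorem IsLattice.hasSum_setIntegral (h : IsLattice N ρ Λ) (hρ : 0 < ρ) (hg : Integrable g m) :
    HasSum (fun p : Λ => ∫ x in ball p ρ, g x ∂m)
      (∫ x, g x ∂Measure.sum fun p : Λ => m.restrict (ball p ρ)) := by
  have := h.countable hρ
  exact hasSum_integral_measure (h.integrable_sum_restrict hg)

theorem IsLattice.integral_le_tsum (h : IsLattice N ρ Λ) (hρ : 0 < ρ) (hg : Integrable g m)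
    (hg0 : 0 ≤ g) : ∫ x, g x ∂m ≤ ∑' p : Λ, ∫ x in ball p ρ, g x ∂m := by
  rw [(h.hasSum_setIntegral hρ hg).tsum_eq]
  exact integral_mono_measure (h.le_sum_restrict hρ m) (ae_of_all _ hg0)
    (h.integrable_sum_restrict hg)

theorem IsLattice.tsum_setIntegral_le (h : IsLattice N ρ Λ) (hρ : 0 < ρ) (hg : Integrable g m)
    (hg0 : 0 ≤ g) : ∑' p : Λ, ∫ x in ball p ρ, g x ∂m ≤ N * ∫ x, g x ∂m := by
  calc ∑' p : Λ, ∫ x in ball p ρ, g x ∂m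
      = ∫ x, g x ∂Measure.sum fun p : Λ => m.restrict (ball p ρ) :=
        (h.hasSum_setIntegral hρ hg).tsum_eq
    _ ≤ ∫ x, g x ∂((N : ℝ≥0∞) • m) :=
        integral_mono_measure (h.sum_restrict_le m) (ae_of_all _ hg0)
          (hg.smul_measure (ENNReal.natCast_ne_top N))
    _ = N * ∫ x, g x ∂m := by
        rw [integral_smul_measure, ENNReal.toReal_natCast, smul_eq_mul]

theorem IsLattice.summable_measureReal (h : IsLattice N ρ Λ) (hρ : 0 < ρ) (m : Measure X)
    [IsFiniteMeasure m] : Summable fun p : Λ => m.real (ball (p : X) ρ) := by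
  simpa using (h.hasSum_setIntegral hρ (integrable_const (μ := m) (1 : ℝ))).summable

theorem IsLattice.tsum_measureReal_le (h : IsLattice N ρ Λ) (hρ : 0 < ρ) (m : Measure X)
    [IsFiniteMeasure m] : ∑' p : Λ, m.real (ball (p : X) ρ) ≤ N * m.real Set.univ := by
  simpa using h.tsum_setIntegral_le hρ (integrable_const (μ := m) (1 : ℝ)) fun _ => zero_le_one

end LatticeSums

section Resolvent

variable {H : Type*} [NormedAddCommGroup H] [InnerProductSpace ℝ H] [CompleteSpace H]
  {S : H →ₗ.[ℝ] H}

theorem inner_eq_of_mem_graph (hS : IsSelfAdjoint S) {a b c d : H} (hab : (a, b) ∈ S.graph)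
    (hcd : (c, d) ∈ S.graph) : inner ℝ b c = inner ℝ a d := by
  rw [← LinearPMap.isSelfAdjoint_def.1 hS,
    LinearPMap.adjoint_graph_eq_graph_adjoint hS.dense_domain, Submodule.mem_adjoint_iff] at hab
  rw [real_inner_comm, ← sub_eq_zero.1 (hab c d hcd), real_inner_comm]

theorem mem_graph_of_forall_inner_eq (hS : IsSelfAdjoint S) {a b : H}
    (h : ∀ c d, (c, d) ∈ S.graph → inner ℝ b c = inner ℝ a d) : (a, b) ∈ S.graph := by
  rw [← LinearPMap.isSelfAdjoint_def.1 hS,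
    LinearPMap.adjoint_graph_eq_graph_adjoint hS.dense_domain, Submodule.mem_adjoint_iff]
  intro c d hcd
  rw [real_inner_comm, ← h c d hcd, real_inner_comm, sub_self]

/-- `J` is the normalised resolvent `β (β + S²)⁻¹` of `S²`: for all `h`, the vector `J h` lies in
the domain of `S²` and `S² (J h) = β (h - J h)`. -/
def IsResolvent (S : H →ₗ.[ℝ] H) (β : ℝ) (J : H →ₗ[ℝ] H) : Prop :=
  ∀ h, ∃ g, (J h, g) ∈ S.graph ∧ (g, β • (h - J h)) ∈ S.graph

/-- The map `(u, z) ↦ (u, c z)` on `H × H` with its Hilbert norm. The preimage of the graph of `S`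
is that graph with the norm `(‖u‖² + c⁻² ‖S u‖²)^{1/2}`. -/
def scaleSnd (c : ℝ) : WithLp 2 (H × H) →L[ℝ] H × H :=
  (WithLp.fstL 2 ℝ H H).prod (c • WithLp.sndL 2 ℝ H H)

-- `J h` minimises `‖u - h‖² + β⁻¹ ‖S u‖²`, so it is an orthogonal projection in a rescaled graph.
theorem exists_isResolvent (hS : IsSelfAdjoint S) {β : ℝ} (hβ : 0 < β) :
    ∃ J, IsResolvent S β J := by
  have hβ' : √β * √β = β := Real.mul_self_sqrt hβ.le
  have hβ0 : √β ≠ 0 := (Real.sqrt_pos.2 hβ).ne'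
  let K : Submodule ℝ (WithLp 2 (H × H)) :=
    S.graph.comap (scaleSnd (H := H) (√β)).toLinearMap
  have hK : IsClosed (K : Set (WithLp 2 (H × H))) :=
    (hS.isClosed : IsClosed (S.graph : Set (H × H))).preimage (scaleSnd (H := H) (√β)).continuous
  have : CompleteSpace K := hK.completeSpace_coe
  let P : H →ₗ[ℝ] WithLp 2 (H × H) := K.starProjection.toLinearMap ∘ₗ
    (WithLp.linearEquiv 2 ℝ (H × H)).symm.toLinearMap ∘ₗ LinearMap.inl ℝ H H
  refine ⟨(WithLp.fstL 2 ℝ H H).toLinearMap ∘ₗ P, fun h => ⟨√β • (P h).snd,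
    K.starProjection_apply_mem _, mem_graph_of_forall_inner_eq hS fun c d hcd => ?_⟩⟩
  have hmem : WithLp.toLp 2 (c, (√β)⁻¹ • d) ∈ K := by
    change (c, √β • (√β)⁻¹ • d) ∈ S.graph
    rwa [smul_inv_smul₀ hβ0]
  have horth := K.starProjection_inner_eq_zero (WithLp.toLp 2 (h, 0)) _ hmem
  rw [WithLp.prod_inner_apply] at horth
  change inner ℝ (h - (P h).fst) c + inner ℝ (0 - (P h).snd) ((√β)⁻¹ • d) = 0 at horth
  change inner ℝ (β • (h - (P h).fst)) c = inner ℝ (√β • (P h).snd) d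
  rw [zero_sub, inner_neg_left, inner_smul_right, ← sub_eq_add_neg, sub_eq_zero] at horth
  rw [real_inner_smul_left, real_inner_smul_left, horth, ← mul_assoc]
  congr 1
  nth_rewrite 1 [← hβ']
  exact mul_inv_cancel_right₀ hβ0 _

variable {β : ℝ} {J : H →ₗ[ℝ] H}

theorem eq_zero_of_mem_graph_neg (hS : IsSelfAdjoint S) (hβ : 0 < β) {a b : H}
    (hab : (a, b) ∈ S.graph) (hba : (b, -(β • a)) ∈ S.graph) : a = 0 := by
  have h := inner_eq_of_mem_graph hS hab hba
  rw [inner_neg_right, inner_smul_right, real_inner_self_eq_norm_sq,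
    real_inner_self_eq_norm_sq] at h
  have hzero : β * ‖a‖ ^ 2 = 0 :=
    le_antisymm (by linarith [sq_nonneg ‖b‖]) (by positivity)
  simpa [hβ.ne'] using hzero

namespace IsResolvent

theorem eq_of_mem_graph (hJ : IsResolvent S β J) (hS : IsSelfAdjoint S) (hβ : 0 < β)
    {h u g : H} (hu : (u, g) ∈ S.graph) (hg : (g, β • (h - u)) ∈ S.graph) : J h = u := by
  obtain ⟨a, ha, ha'⟩ := hJ h
  refine sub_eq_zero.1 (eq_zero_of_mem_graph_neg hS hβ (S.graph.sub_mem ha hu) ?_)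
  convert S.graph.sub_mem ha' hg using 1
  rw [Prod.mk_sub_mk]
  congr 1
  module

theorem mem_graph (hJ : IsResolvent S β J) (hS : IsSelfAdjoint S) (hβ : 0 < β)
    {f f' : H} (hf : (f, f') ∈ S.graph) : (J f, J f') ∈ S.graph := by
  obtain ⟨b, hb, hb'⟩ := hJ f'
  have he : (f - β⁻¹ • b, J f') ∈ S.graph := by
    have := S.graph.sub_mem hf (S.graph.smul_mem β⁻¹ hb')
    rwa [Prod.smul_mk, inv_smul_smul₀ hβ.ne', Prod.mk_sub_mk, sub_sub_cancel] at this
  have hb_eq : β • (f - (f - β⁻¹ • b)) = b := by rw [sub_sub_cancel, smul_inv_smul₀ hβ.ne']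
  rwa [hJ.eq_of_mem_graph hS hβ he (hb_eq.symm ▸ hb)]

theorem graph_resolvent (hJ : IsResolvent S β J) (hS : IsSelfAdjoint S) (hβ : 0 < β)
    {f f' : H} (hf : (f, f') ∈ S.graph) : (J f', β • (f - J f)) ∈ S.graph := by
  obtain ⟨a, ha, ha'⟩ := hJ f
  rwa [S.mem_graph_snd_inj ha (hJ.mem_graph hS hβ hf) rfl] at ha'

theorem symm (hJ : IsResolvent S β J) (hS : IsSelfAdjoint S) (hβ : 0 < β) (f g : H) :
    inner ℝ (J f) g = inner ℝ f (J g) := by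
  obtain ⟨a, ha, ha'⟩ := hJ f
  obtain ⟨b, hb, hb'⟩ := hJ g
  have hfg : inner ℝ a b = β * (inner ℝ (J f) g - inner ℝ (J f) (J g)) := by
    rw [inner_eq_of_mem_graph hS ha hb', inner_smul_right, inner_sub_right]
  have hgf : β * (inner ℝ f (J g) - inner ℝ (J f) (J g)) = inner ℝ a b := by
    rw [← inner_eq_of_mem_graph hS ha' hb, real_inner_smul_left, inner_sub_left]
  linarith [mul_left_cancel₀ hβ.ne' (hgf.trans hfg)]

theorem norm_le (hJ : IsResolvent S β J) (hS : IsSelfAdjoint S) (hβ : 0 < β) (f : H) :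
    ‖J f‖ ≤ ‖f‖ := by
  obtain ⟨a, ha, ha'⟩ := hJ f
  have hinner : 0 ≤ inner ℝ (J f) (f - J f) := by
    refine nonneg_of_mul_nonneg_right ?_ hβ
    rw [← inner_smul_right, ← inner_eq_of_mem_graph hS ha ha']
    exact real_inner_self_nonneg
  rw [inner_sub_right, real_inner_self_eq_norm_sq, sub_nonneg] at hinner
  by_contra! hlt
  nlinarith [norm_nonneg f, real_inner_le_norm (J f) f]

theorem inner_sub_eq (hJ : IsResolvent S β J) (hS : IsSelfAdjoint S) (hβ : 0 < β)
    {f f' g g' : H} (hf : (f, f') ∈ S.graph) (hg : (g, g') ∈ S.graph) :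
    β * inner ℝ (f - J f) g = inner ℝ (J f') g' := by
  rw [← real_inner_smul_left, inner_eq_of_mem_graph hS (hJ.graph_resolvent hS hβ hf) hg]

theorem mul_norm_sub_sq_le (hJ : IsResolvent S β J) (hS : IsSelfAdjoint S) (hβ : 0 < β)
    {f f' : H} (hf : (f, f') ∈ S.graph) : β * ‖f - J f‖ ^ 2 ≤ ‖f'‖ ^ 2 := by
  have hJf' : inner ℝ (J f') f' ≤ ‖f'‖ ^ 2 :=
    calc inner ℝ (J f') f' ≤ ‖J f'‖ * ‖f'‖ := real_inner_le_norm _ _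
      _ ≤ ‖f'‖ * ‖f'‖ := by gcongr; exact hJ.norm_le hS hβ f'
      _ = ‖f'‖ ^ 2 := (sq _).symm
  calc β * ‖f - J f‖ ^ 2 = inner ℝ (J f') (f' - J f') := by
        rw [← real_inner_self_eq_norm_sq,
          hJ.inner_sub_eq hS hβ hf (S.graph.sub_mem hf (hJ.mem_graph hS hβ hf))]
    _ = inner ℝ (J f') f' - ‖J f'‖ ^ 2 := by rw [inner_sub_right, real_inner_self_eq_norm_sq]
    _ ≤ ‖f'‖ ^ 2 := by linarith [sq_nonneg ‖J f'‖]

theorem variational_inequality (hJ : IsResolvent S β J) (hS : IsSelfAdjoint S)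
    {h u' v v' : H} (hu : (J h, u') ∈ S.graph) (hv : (v, v') ∈ S.graph) :
    β * ‖J h - h‖ ^ 2 + ‖u'‖ ^ 2 + β * ‖v - J h‖ ^ 2 ≤ β * ‖v - h‖ ^ 2 + ‖v'‖ ^ 2 := by
  obtain ⟨a, ha, ha'⟩ := hJ h
  obtain rfl : a = u' := S.mem_graph_snd_inj ha hu rfl
  have hcross : β * inner ℝ (h - J h) (v - J h) = inner ℝ a (v' - a) := by
    rw [← real_inner_smul_left]
    exact inner_eq_of_mem_graph hS ha' (S.graph.sub_mem hv hu)
  have hv_sub : ‖v - h‖ ^ 2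
      = ‖v - J h‖ ^ 2 - 2 * inner ℝ (h - J h) (v - J h) + ‖J h - h‖ ^ 2 := by
    rw [← sub_sub_sub_cancel_right v h (J h), norm_sub_sq_real, real_inner_comm, norm_sub_rev h]
  have hv' : ‖v'‖ ^ 2 = ‖v' - a‖ ^ 2 + 2 * inner ℝ a (v' - a) + ‖a‖ ^ 2 := by
    nth_rewrite 1 [← sub_add_cancel v' a]
    rw [norm_add_sq_real, real_inner_comm]
  rw [hv_sub, hv', ← hcross]
  linarith [sq_nonneg ‖v' - a‖]

end IsResolvent

variable {b : ℕ → ℝ} {R : ℕ → H →ₗ[ℝ] H}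

theorem exists_resolvent_seq (hS : IsSelfAdjoint S) :
    ∃ (b : ℕ → ℝ) (R : ℕ → H →ₗ[ℝ] H), (∀ n, 0 < b n) ∧ Tendsto b atTop atTop ∧
      ∀ n, IsResolvent S (b n) (R n) := by
  choose R hR using fun n : ℕ => exists_isResolvent hS (β := n + 1) (by positivity)
  exact ⟨_, R, fun n => by positivity,
    tendsto_atTop_add_const_right _ _ tendsto_natCast_atTop_atTop, hR⟩

theorem tendsto_resolvent_of_mem_graph (hS : IsSelfAdjoint S) (hb : ∀ n, 0 < b n)
    (hb_top : Tendsto b atTop atTop) (hR : ∀ n, IsResolvent S (b n) (R n)) {f f' : H}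
    (hf : (f, f') ∈ S.graph) : Tendsto (fun n => R n f) atTop (𝓝 f) := by
  have hlim : Tendsto (fun n => ‖f'‖ ^ 2 / b n) atTop (𝓝 0) := hb_top.const_div_atTop _
  have hsq : Tendsto (fun n => ‖f - R n f‖ ^ 2) atTop (𝓝 0) :=
    squeeze_zero (fun _ => sq_nonneg _)
      (fun n => (le_div_iff₀' (hb n)).2 ((hR n).mul_norm_sub_sq_le hS (hb n) hf)) hlim
  rw [tendsto_iff_norm_sub_tendsto_zero]
  simpa [norm_sub_rev] using hsq.sqrt

theorem tendsto_resolvent (hS : IsSelfAdjoint S) (hb : ∀ n, 0 < b n)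
    (hb_top : Tendsto b atTop atTop) (hR : ∀ n, IsResolvent S (b n) (R n)) (f : H) :
    Tendsto (fun n => R n f) atTop (𝓝 f) := by
  refine Metric.tendsto_atTop'.2 fun δ hδ => ?_
  obtain ⟨w, hwf, hw⟩ := Metric.dense_iff.1 hS.dense_domain f (δ / 3) (by positivity)
  rw [mem_ball, dist_comm] at hwf
  obtain ⟨w', hww'⟩ := LinearPMap.mem_domain_iff.1 hw
  obtain ⟨n₀, hn₀⟩ := Metric.tendsto_atTop'.1
    (tendsto_resolvent_of_mem_graph hS hb hb_top hR hww') (δ / 3) (by positivity)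
  refine ⟨n₀, fun n hn => ?_⟩
  have hRfw : dist (R n f) (R n w) ≤ dist f w := by
    rw [dist_eq_norm, dist_eq_norm, ← map_sub]
    exact (hR n).norm_le hS (hb n) _
  calc dist (R n f) f ≤ dist (R n f) (R n w) + dist (R n w) w + dist w f := dist_triangle4 _ _ _ _
    _ < δ := by linarith [hn₀ n hn, dist_comm w f]

theorem tendsto_resolvent_form (hS : IsSelfAdjoint S) (hb : ∀ n, 0 < b n)
    (hb_top : Tendsto b atTop atTop) (hR : ∀ n, IsResolvent S (b n) (R n))
    {f f' g g' : H} (hf : (f, f') ∈ S.graph) (hg : (g, g') ∈ S.graph) :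
    Tendsto (fun n => b n * inner ℝ (f - R n f) g) atTop (𝓝 (inner ℝ f' g')) := by
  simp_rw [fun n => (hR n).inner_sub_eq hS (hb n) hf hg]
  exact (tendsto_resolvent hS hb hb_top hR f').inner tendsto_const_nhds

-- Case distinction on whether the root exists, so that no existence theorem for it is needed.
theorem isNonnegSqrt_sqrtOp_or_eq_zero (A : H →ₗ.[ℝ] H) :
    IsNonnegSqrt A (sqrtOp A) ∨ sqrtOp A = 0 := by
  unfold sqrtOp
  split_ifs with h
  · exact Or.inl h.choose_spec
  · exact Or.inr rfl

theorem isSelfAdjoint_zero : IsSelfAdjoint (0 : H →ₗ.[ℝ] H) := by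
  have hle : (0 : H →ₗ.[ℝ] H) ≤ LinearPMap.adjoint (0 : H →ₗ.[ℝ] H) :=
    LinearPMap.IsFormalAdjoint.le_adjoint (by simp) fun x y =>
      (inner_zero_left (y : H)).trans (inner_zero_right (x : H)).symm
  exact (LinearPMap.eq_of_le_of_domain_eq hle (le_antisymm hle.1 le_top)).symm

theorem isSelfAdjoint_sqrtOp (A : H →ₗ.[ℝ] H) : IsSelfAdjoint (sqrtOp A) := by
  rcases isNonnegSqrt_sqrtOp_or_eq_zero A with h | h
  · exact h.selfAdjoint
  · exact h ▸ isSelfAdjoint_zero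

theorem exists_seq_mem_domain_tendsto {A : H →ₗ.[ℝ] H} (hA : IsSelfAdjoint A) {f f' : H}
    (hf : (f, f') ∈ (sqrtOp A).graph) :
    ∃ g g' : ℕ → H, (∀ n, g n ∈ A.domain ∧ (g n, g' n) ∈ (sqrtOp A).graph) ∧
      Tendsto g atTop (𝓝 f) ∧ Tendsto g' atTop (𝓝 f') := by
  rcases isNonnegSqrt_sqrtOp_or_eq_zero A with h | h
  · have hS := h.selfAdjoint
    obtain ⟨b, R, hb, hb_top, hR⟩ := exists_resolvent_seq hS
    refine ⟨fun n => R n f, fun n => R n f', fun n => ⟨?_, (hR n).mem_graph hS (hb n) hf⟩,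
      tendsto_resolvent hS hb hb_top hR f, tendsto_resolvent hS hb hb_top hR f'⟩
    obtain ⟨a, ha, ha'⟩ := hR n f
    exact LinearPMap.mem_domain_of_mem_graph ((h.square _ _).2 ⟨a, ha, ha'⟩)
  · have hzero : ∀ x, (x, (0 : H)) ∈ (sqrtOp A).graph := fun x => by
      rw [h]
      exact (0 : H →ₗ.[ℝ] H).mem_graph ⟨x, trivial⟩
    obtain rfl : f' = 0 := (sqrtOp A).mem_graph_snd_inj hf (hzero f) rfl
    obtain ⟨g, hg, hlim⟩ := mem_closure_iff_seq_limit.1 (hA.dense_domain f)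
    exact ⟨g, fun _ => 0, fun n => ⟨hg n, hzero _⟩, hlim, tendsto_const_nhds⟩

end Resolvent

section SubMarkov

variable {X : Type*} [MeasurableSpace X] {μ : Measure X}

theorem inner_eq_integral_mul (f g : Lp ℝ 2 μ) : inner ℝ f g = ∫ x, f x * g x ∂μ := by
  rw [L2.inner_def]
  simp [mul_comm]

theorem norm_sq_eq_integral_sq (f : Lp ℝ 2 μ) : ‖f‖ ^ 2 = ∫ x, f x ^ 2 ∂μ := by
  simp_rw [← real_inner_self_eq_norm_sq, inner_eq_integral_mul, sq]

theorem integrable_mul_Lp (f g : Lp ℝ 2 μ) : Integrable (fun x => f x * g x) μ :=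
  (Lp.memLp f).integrable_mul (Lp.memLp g)

theorem indicatorConstLp_one_mem_Icc {s : Set X} (hs : MeasurableSet s) (hμs : μ s ≠ ∞) :
    ∀ᵐ x ∂μ, indicatorConstLp 2 hs hμs (1 : ℝ) x ∈ Set.Icc 0 1 := by
  filter_upwards [indicatorConstLp_coeFn (p := 2) (hs := hs) (hμs := hμs) (c := (1 : ℝ))]
    with x hx
  rw [hx]
  exact ⟨Set.indicator_nonneg (fun _ _ => zero_le_one) x,
    Set.indicator_le_self' (fun _ _ => zero_le_one) x⟩

/-- A symmetric sub-Markovian contraction of `L²`. -/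
structure IsSubMarkov (A : Lp ℝ 2 μ →ₗ[ℝ] Lp ℝ 2 μ) : Prop where
  symm : ∀ f g, inner ℝ (A f) g = inner ℝ f (A g)
  norm_le : ∀ f, ‖A f‖ ≤ ‖f‖
  mem_Icc : ∀ f : Lp ℝ 2 μ, (∀ᵐ x ∂μ, f x ∈ Set.Icc 0 1) → ∀ᵐ x ∂μ, A f x ∈ Set.Icc 0 1

/-- The carré du champ `(v + A v) / 2 - f A f` of the form `⟨f - A f, f⟩`. In all uses `v = f²`,
which is passed as a separate argument since it need not be square integrable. -/
noncomputable def carreDuChamp (A : Lp ℝ 2 μ →ₗ[ℝ] Lp ℝ 2 μ) (f v : Lp ℝ 2 μ) (x : X) : ℝ :=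
  2⁻¹ * v x - A f x * f x + 2⁻¹ * A v x

theorem inner_sub_apply_self_nonneg {H : Type*} [NormedAddCommGroup H] [InnerProductSpace ℝ H]
    {A : H →ₗ[ℝ] H} (hA : ∀ f, ‖A f‖ ≤ ‖f‖) (f : H) : 0 ≤ inner ℝ (f - A f) f := by
  rw [inner_sub_left, real_inner_self_eq_norm_mul_norm, sub_nonneg]
  exact (real_inner_le_norm (A f) f).trans (by gcongr; exact hA f)

theorem truncation_sub_mul_nonneg {a y k : ℝ} (ha : -k ≤ a) (ha' : a ≤ k) :
    0 ≤ (max (-k) (min y k) - a) * (y - max (-k) (min y k)) := by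
  rcases le_total y k with hyk | hyk
  · rcases le_total (-k) y with hky | hky
    · simp [min_eq_left hyk, max_eq_right hky]
    · rw [min_eq_left hyk, max_eq_left hky]
      exact mul_nonneg_of_nonpos_of_nonpos (by linarith) (by linarith)
  · rw [min_eq_right hyk, max_eq_right (ha.trans ha')]
    exact mul_nonneg (by linarith) (by linarith)

theorem abs_unitContraction_sub_le {a b : ℝ} (hb : b ∈ Set.Icc (0 : ℝ) 1) :
    |max 0 (min a 1) - b| ≤ |a - b| := by
  have hmin : |min a 1 - b| ≤ |a - b| := by
    simpa [min_eq_left hb.2] using abs_min_sub_min_le_max a 1 b 1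
  have hmax : |max 0 (min a 1) - b| ≤ |min a 1 - b| := by
    simpa [max_eq_right hb.1] using abs_max_sub_max_le_max 0 (min a 1) 0 b
  exact hmax.trans hmin

namespace IsSubMarkov

variable {A : Lp ℝ 2 μ →ₗ[ℝ] Lp ℝ 2 μ} {f g u v p : Lp ℝ 2 μ} {k : ℝ}

section SigmaFinite

variable [SigmaFinite μ]

theorem nonneg (hA : IsSubMarkov A) (hf : ∀ᵐ x ∂μ, 0 ≤ f x) : ∀ᵐ x ∂μ, 0 ≤ A f x := by
  refine ae_nonneg_of_forall_setIntegral_nonneg_of_sigmaFinite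
    (fun s _ hμs => integrableOn_Lp_of_measure_ne_top _ (by norm_num) hμs.ne) fun s hs hμs => ?_
  rw [← L2.inner_indicatorConstLp_one hs hμs.ne, ← hA.symm, inner_eq_integral_mul]
  refine integral_nonneg_of_ae ?_
  filter_upwards [hf, hA.mem_Icc _ (indicatorConstLp_one_mem_Icc hs hμs.ne)] with x hfx hx
  exact mul_nonneg hx.1 hfx

theorem mono (hA : IsSubMarkov A) (hfg : ∀ᵐ x ∂μ, f x ≤ g x) : ∀ᵐ x ∂μ, A f x ≤ A g x := by
  have hsub : ∀ᵐ x ∂μ, 0 ≤ (g - f) x := by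
    filter_upwards [hfg, Lp.coeFn_sub g f] with x hx hx'
    rw [hx', Pi.sub_apply]
    exact sub_nonneg.2 hx
  have h := hA.nonneg hsub
  rw [map_sub] at h
  filter_upwards [h, Lp.coeFn_sub (A g) (A f)] with x hx hx'
  rw [hx', Pi.sub_apply] at hx
  exact sub_nonneg.1 hx

theorem le_const (hA : IsSubMarkov A) (hk : 0 ≤ k) (hf : ∀ᵐ x ∂μ, f x ≤ k) :
    ∀ᵐ x ∂μ, A f x ≤ k := by
  rcases hk.eq_or_lt with rfl | hk
  · have h0 := Lp.coeFn_zero ℝ 2 μ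
    have h := hA.mono (g := 0) (by filter_upwards [hf, h0] with x hx hx0 using hx.trans_eq hx0.symm)
    rw [map_zero] at h
    filter_upwards [h, h0] with x hx hx0 using hx.trans_eq hx0
  have hscaled : ∀ᵐ x ∂μ, (k⁻¹ • Lp.posPart f) x ∈ Set.Icc 0 1 := by
    filter_upwards [hf, Lp.coeFn_smul k⁻¹ (Lp.posPart f), Lp.coeFn_posPart f] with x hx hsmul hpos
    rw [hsmul, Pi.smul_apply, hpos, smul_eq_mul]
    exact ⟨by positivity, (inv_mul_le_one₀ hk).2 (max_le hx hk.le)⟩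
  have hle : ∀ᵐ x ∂μ, f x ≤ Lp.posPart f x := by
    filter_upwards [Lp.coeFn_posPart f] with x hpos
    exact hpos ▸ le_max_left _ _
  have hscaled' := hA.mem_Icc _ hscaled
  rw [map_smul] at hscaled'
  filter_upwards [hA.mono hle, hscaled', Lp.coeFn_smul k⁻¹ (A (Lp.posPart f))] with x hx hx1 hsmul
  rw [hsmul, Pi.smul_apply, smul_eq_mul] at hx1
  exact hx.trans ((inv_mul_le_one₀ hk).1 hx1.2)

theorem neg_const_le (hA : IsSubMarkov A) (hk : 0 ≤ k) (hf : ∀ᵐ x ∂μ, -k ≤ f x) :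
    ∀ᵐ x ∂μ, -k ≤ A f x := by
  have h := hA.le_const (f := -f) hk (by
    filter_upwards [hf, Lp.coeFn_neg f] with x hx hneg
    rw [hneg, Pi.neg_apply]
    linarith)
  rw [map_neg] at h
  filter_upwards [h, Lp.coeFn_neg (A f)] with x hx hneg
  rw [hneg, Pi.neg_apply] at hx
  linarith

theorem inner_truncation_le (hA : IsSubMarkov A) (hk : 0 ≤ k)
    (hg : g =ᵐ[μ] fun x => max (-k) (min (f x) k)) :
    inner ℝ (g - A g) g ≤ inner ℝ (f - A f) f := by
  obtain ⟨h, rfl⟩ : ∃ h, f = g + h := ⟨f - g, (add_sub_cancel g f).symm⟩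
  have hlow : ∀ᵐ x ∂μ, -k ≤ g x := hg.mono fun x hx => hx ▸ le_max_left _ _
  have hup : ∀ᵐ x ∂μ, g x ≤ k :=
    hg.mono fun x hx => hx ▸ max_le (by linarith) (min_le_right _ _)
  have hcross : 0 ≤ inner ℝ (g - A g) h := by
    rw [inner_eq_integral_mul]
    refine integral_nonneg_of_ae ?_
    filter_upwards [hg, hA.neg_const_le hk hlow, hA.le_const hk hup, Lp.coeFn_sub g (A g),
      Lp.coeFn_add g h] with x hgx hAlow hAup hsub hadd
    have hmul := truncation_sub_mul_nonneg (y := (g + h) x) hAlow hAup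
    rwa [← hgx, hadd, Pi.add_apply, add_sub_cancel_left, ← Pi.sub_apply, ← hsub] at hmul
  have hexpand : inner ℝ (g + h - A (g + h)) (g + h)
      = inner ℝ (g - A g) g + 2 * inner ℝ (g - A g) h + inner ℝ (h - A h) h := by
    simp only [map_add, inner_sub_left, inner_add_left, inner_add_right]
    linarith [hA.symm h g, real_inner_comm h g, real_inner_comm (A g) h]
  linarith [inner_sub_apply_self_nonneg hA.norm_le h]

-- Only positivity is used: `2 c f - c² ≤ f²` for every rational `c`, hence `2 c A f - c² ≤ A (f²)`.
theorem sq_le (hA : IsSubMarkov A) (hv : v =ᵐ[μ] fun x => f x ^ 2) :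
    ∀ᵐ x ∂μ, A f x ^ 2 ≤ A v x := by
  have hrat : ∀ c : ℚ, ∀ᵐ x ∂μ, 2 * c * A f x - (c : ℝ) ^ 2 ≤ A v x := by
    intro c
    have hlow : ∀ᵐ x ∂μ, -(c : ℝ) ^ 2 ≤ (v - (2 * c : ℝ) • f) x := by
      filter_upwards [hv, Lp.coeFn_sub v ((2 * c : ℝ) • f), Lp.coeFn_smul (2 * c : ℝ) f]
        with x hvx hsub hsmul
      rw [hsub, Pi.sub_apply, hsmul, hvx, Pi.smul_apply, smul_eq_mul]
      linarith [sq_nonneg (f x - c)]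
    have h := hA.neg_const_le (sq_nonneg (c : ℝ)) hlow
    rw [map_sub, map_smul] at h
    filter_upwards [h, Lp.coeFn_sub (A v) ((2 * c : ℝ) • A f), Lp.coeFn_smul (2 * c : ℝ) (A f)]
      with x hx hsub hsmul
    rw [hsub, Pi.sub_apply, hsmul, Pi.smul_apply, smul_eq_mul] at hx
    linarith
  filter_upwards [ae_all_iff.2 hrat] with x hx
  have hreal : ∀ c : ℝ, 2 * c * A f x - c ^ 2 ≤ A v x := fun c =>
    Rat.denseRange_cast.induction_on (p := fun c : ℝ => 2 * c * A f x - c ^ 2 ≤ A v x) c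
      (isClosed_le (by fun_prop) continuous_const) hx
  linarith [hreal (A f x)]

theorem setLIntegral_enorm_le (hA : IsSubMarkov A) (hf0 : ∀ᵐ x ∂μ, 0 ≤ f x)
    (hf : Integrable f μ) {s : Set X} (hs : MeasurableSet s) (hμs : μ s ≠ ∞) :
    ∫⁻ x in s, ‖A f x‖ₑ ∂μ ≤ ENNReal.ofReal (∫ x, f x ∂μ) := by
  have hset : ∫ x in s, A f x ∂μ ≤ ∫ x, f x ∂μ := by
    rw [← L2.inner_indicatorConstLp_one hs hμs, ← hA.symm, inner_eq_integral_mul]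
    refine integral_mono_ae (integrable_mul_Lp _ _) hf ?_
    filter_upwards [hA.mem_Icc _ (indicatorConstLp_one_mem_Icc hs hμs), hf0] with x hx hfx
    exact mul_le_of_le_one_left hfx hx.2
  have hint : IntegrableOn (A f) s μ := integrableOn_Lp_of_measure_ne_top _ (by norm_num) hμs
  rw [← ofReal_integral_norm_eq_lintegral_enorm hint]
  refine ENNReal.ofReal_le_ofReal ((integral_congr_ae ?_).trans_le hset)
  filter_upwards [ae_restrict_of_ae (hA.nonneg hf0)] with x hx
  exact Real.norm_of_nonneg hx

theorem integrable (hA : IsSubMarkov A) (hf0 : ∀ᵐ x ∂μ, 0 ≤ f x) (hf : Integrable f μ) :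
    Integrable (A f) μ :=
  integrable_of_forall_fin_meas_le _ ENNReal.ofReal_lt_top (Lp.aestronglyMeasurable _)
    fun _ hs hμs => hA.setLIntegral_enorm_le hf0 hf hs hμs

theorem integral_le (hA : IsSubMarkov A) (hf0 : ∀ᵐ x ∂μ, 0 ≤ f x) (hf : Integrable f μ) :
    ∫ x, A f x ∂μ ≤ ∫ x, f x ∂μ := by
  have h := lintegral_le_of_forall_fin_meas_le _
    fun _ hs hμs => hA.setLIntegral_enorm_le hf0 hf hs hμs
  rw [← ofReal_integral_norm_eq_lintegral_enorm (hA.integrable hf0 hf),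
    ENNReal.ofReal_le_ofReal_iff (integral_nonneg_of_ae hf0)] at h
  exact (integral_mono (hA.integrable hf0 hf) (hA.integrable hf0 hf).norm
    fun x => Real.le_norm_self _).trans h

theorem carreDuChamp_nonneg (hA : IsSubMarkov A) (hv : v =ᵐ[μ] fun x => f x ^ 2) :
    ∀ᵐ x ∂μ, 0 ≤ carreDuChamp A f v x := by
  filter_upwards [hA.sq_le hv, hv] with x hsq hvx
  rw [carreDuChamp, hvx]
  linarith [sq_nonneg (f x - A f x)]

theorem integrable_carreDuChamp (hA : IsSubMarkov A) (hv : v =ᵐ[μ] fun x => f x ^ 2) :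
    Integrable (carreDuChamp A f v) μ := by
  have hv0 : ∀ᵐ x ∂μ, 0 ≤ v x := hv.mono fun x hx => hx ▸ sq_nonneg (f x)
  have hvint : Integrable v μ := (Lp.memLp f).integrable_sq.congr hv.symm
  exact ((hvint.const_mul _).sub (integrable_mul_Lp _ _)).add
    ((hA.integrable hv0 hvint).const_mul _)

theorem integral_carreDuChamp_le (hA : IsSubMarkov A) (hv : v =ᵐ[μ] fun x => f x ^ 2) :
    ∫ x, carreDuChamp A f v x ∂μ ≤ inner ℝ (f - A f) f := by
  have hv0 : ∀ᵐ x ∂μ, 0 ≤ v x := hv.mono fun x hx => hx ▸ sq_nonneg (f x)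
  have hvint : Integrable v μ := (Lp.memLp f).integrable_sq.congr hv.symm
  have hff : inner ℝ f f = ∫ x, v x ∂μ := by
    rw [inner_eq_integral_mul]
    exact integral_congr_ae (hv.mono fun x hx => ((hx.trans (sq _)).symm :))
  have hAv := (hA.integrable hv0 hvint).const_mul 2⁻¹
  have hAf : Integrable (fun x => 2⁻¹ * v x - A f x * f x) μ :=
    (hvint.const_mul _).sub (integrable_mul_Lp _ _)
  calc ∫ x, carreDuChamp A f v x ∂μ
      = 2⁻¹ * ∫ x, v x ∂μ - inner ℝ (A f) f + 2⁻¹ * ∫ x, A v x ∂μ := by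
        simp only [carreDuChamp]
        rw [inner_eq_integral_mul, integral_add hAf hAv,
          integral_sub (hvint.const_mul _) (integrable_mul_Lp _ _), integral_const_mul,
          integral_const_mul]
    _ ≤ 2⁻¹ * ∫ x, v x ∂μ - inner ℝ (A f) f + 2⁻¹ * ∫ x, v x ∂μ := by
        linarith [hA.integral_le hv0 hvint]
    _ = inner ℝ (f - A f) f := by
        rw [inner_sub_left, hff]
        ring

end SigmaFinite

end IsSubMarkov

theorem mul_carreDuChamp_ae_eq {A : Lp ℝ 2 μ →ₗ[ℝ] Lp ℝ 2 μ} {f u v p : Lp ℝ 2 μ}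
    (hu : u =ᵐ[μ] fun x => f x * p x) (hv : v =ᵐ[μ] fun x => f x ^ 2) :
    (fun x => p x * carreDuChamp A f v x)
      =ᵐ[μ] fun x => (f - A f) x * u x - 2⁻¹ * ((v - A v) x * p x) := by
  filter_upwards [hu, hv, Lp.coeFn_sub f (A f), Lp.coeFn_sub v (A v)] with x hux hvx hf hv'
  rw [hf, hv', Pi.sub_apply, Pi.sub_apply, hux, carreDuChamp, hvx]
  ring

theorem integral_mul_carreDuChamp {A : Lp ℝ 2 μ →ₗ[ℝ] Lp ℝ 2 μ} {f u v p : Lp ℝ 2 μ}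
    (hu : u =ᵐ[μ] fun x => f x * p x) (hv : v =ᵐ[μ] fun x => f x ^ 2) :
    ∫ x, p x * carreDuChamp A f v x ∂μ = inner ℝ (f - A f) u - 2⁻¹ * inner ℝ (v - A v) p := by
  rw [integral_congr_ae (mul_carreDuChamp_ae_eq hu hv),
    integral_sub (integrable_mul_Lp _ _) ((integrable_mul_Lp _ _).const_mul _),
    integral_const_mul, ← inner_eq_integral_mul, ← inner_eq_integral_mul]

theorem IsSubMarkov.inner_sub_half_inner_le [SigmaFinite μ] {A : Lp ℝ 2 μ →ₗ[ℝ] Lp ℝ 2 μ}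
    (hA : IsSubMarkov A) {f u v p : Lp ℝ 2 μ} {c : ℝ} (hc : 0 ≤ c)
    (hu : u =ᵐ[μ] fun x => f x * p x) (hv : v =ᵐ[μ] fun x => f x ^ 2)
    (hp : ∀ᵐ x ∂μ, p x ≤ c) :
    inner ℝ (f - A f) u - 2⁻¹ * inner ℝ (v - A v) p ≤ c * inner ℝ (f - A f) f := by
  have hint : Integrable (fun x => p x * carreDuChamp A f v x) μ :=
    ((integrable_mul_Lp _ _).sub ((integrable_mul_Lp _ _).const_mul _)).congr
      (mul_carreDuChamp_ae_eq hu hv).symm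
  calc inner ℝ (f - A f) u - 2⁻¹ * inner ℝ (v - A v) p
      = ∫ x, p x * carreDuChamp A f v x ∂μ := (integral_mul_carreDuChamp hu hv).symm
    _ ≤ ∫ x, c * carreDuChamp A f v x ∂μ := by
        refine integral_mono_ae hint ((hA.integrable_carreDuChamp hv).const_mul c) ?_
        filter_upwards [hp, hA.carreDuChamp_nonneg hv] with x hpx hx
        exact mul_le_mul_of_nonneg_right hpx hx
    _ = c * ∫ x, carreDuChamp A f v x ∂μ := integral_const_mul _ _
    _ ≤ c * inner ℝ (f - A f) f := by
        gcongr
        exact hA.integral_carreDuChamp_le hv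

variable {S : Lp ℝ 2 μ →ₗ.[ℝ] Lp ℝ 2 μ} {β : ℝ} {J : Lp ℝ 2 μ →ₗ[ℝ] Lp ℝ 2 μ}

/-- The unit contraction `f ↦ max 0 (min f 1)` operates on the form `‖S f‖²`. -/
def UnitContractionOperates (S : Lp ℝ 2 μ →ₗ.[ℝ] Lp ℝ 2 μ) : Prop :=
  ∀ f f', (f, f') ∈ S.graph → ∃ g g', (g, g') ∈ S.graph ∧
    (g =ᵐ[μ] fun x => max 0 (min (f x) 1)) ∧ ‖g'‖ ≤ ‖f'‖

-- The unit contraction of `J h` is again a minimiser of the functional minimised by `J h`.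
theorem IsResolvent.mem_Icc (hJ : IsResolvent S β J) (hS : IsSelfAdjoint S) (hβ : 0 < β)
    (hc : UnitContractionOperates S) {h : Lp ℝ 2 μ} (hh : ∀ᵐ x ∂μ, h x ∈ Set.Icc 0 1) :
    ∀ᵐ x ∂μ, J h x ∈ Set.Icc 0 1 := by
  obtain ⟨u', hu, -⟩ := hJ h
  obtain ⟨w, w', hw, hwu, hw'⟩ := hc _ _ hu
  have hnorm : ‖w - h‖ ≤ ‖J h - h‖ := by
    refine Lp.norm_le_norm_of_ae_le ?_
    filter_upwards [hh, hwu, Lp.coeFn_sub w h, Lp.coeFn_sub (J h) h] with x hx hwx hsub hsub'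
    rw [hsub, hsub', Pi.sub_apply, Pi.sub_apply, hwx, Real.norm_eq_abs, Real.norm_eq_abs]
    exact abs_unitContraction_sub_le hx
  have hgap : β * ‖w - J h‖ ^ 2 ≤ 0 := by
    have hsq : β * ‖w - h‖ ^ 2 ≤ β * ‖J h - h‖ ^ 2 := by gcongr
    have hsq' : ‖w'‖ ^ 2 ≤ ‖u'‖ ^ 2 := by gcongr
    linarith [hJ.variational_inequality hS hu hw]
  have hwJ : w = J h := by
    have hzero := nonpos_of_mul_nonpos_right hgap hβ
    exact sub_eq_zero.1 (norm_eq_zero.1 (pow_eq_zero_iff two_ne_zero |>.1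
      (hzero.antisymm (sq_nonneg _))))
  filter_upwards [hwJ ▸ hwu] with x hx
  rw [hx]
  exact ⟨le_max_left _ _, max_le zero_le_one (min_le_right _ _)⟩

theorem IsResolvent.isSubMarkov (hJ : IsResolvent S β J) (hS : IsSelfAdjoint S) (hβ : 0 < β)
    (hc : UnitContractionOperates S) : IsSubMarkov J where
  symm := hJ.symm hS hβ
  norm_le := hJ.norm_le hS hβ
  mem_Icc _ := hJ.mem_Icc hS hβ hc

end SubMarkov

section Energy

section Form

variable {X : Type*} [MeasurableSpace X] {μ : Measure X} {L : Lp ℝ 2 μ →ₗ.[ℝ] Lp ℝ 2 μ}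

theorem form_self (f : (sqrtOp L).domain) : form L f f = ‖sqrtOp L f‖ ^ 2 :=
  real_inner_self_eq_norm_sq _

theorem form_self_nonneg (f : (sqrtOp L).domain) : 0 ≤ form L f f :=
  real_inner_self_nonneg

theorem IsDirichlet.unitContractionOperates (h : IsDirichlet L) :
    UnitContractionOperates (sqrtOp L) := by
  intro f f' hf
  obtain ⟨y, rfl, rfl⟩ := (LinearPMap.mem_graph_iff _).1 hf
  obtain ⟨g, hg, hle⟩ := h y
  refine ⟨g, sqrtOp L g, LinearPMap.mem_graph _ g, hg, ?_⟩
  rw [form_self, form_self] at hle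
  exact (sq_le_sq₀ (norm_nonneg _) (norm_nonneg _)).1 hle

theorem IsDirichlet.exists_isSubMarkov_tendsto_form (h : IsDirichlet L) :
    ∃ (b : ℕ → ℝ) (A : ℕ → Lp ℝ 2 μ →ₗ[ℝ] Lp ℝ 2 μ),
      (∀ n, 0 < b n) ∧ (∀ n, IsSubMarkov (A n)) ∧
      ∀ f g : (sqrtOp L).domain,
        Tendsto (fun n => b n * inner ℝ ((f : Lp ℝ 2 μ) - A n f) (g : Lp ℝ 2 μ)) atTop
          (𝓝 (form L f g)) := by
  have hS := isSelfAdjoint_sqrtOp L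
  obtain ⟨b, R, hb, hb_top, hR⟩ := exists_resolvent_seq hS
  exact ⟨b, R, hb, fun n => (hR n).isSubMarkov hS (hb n) h.unitContractionOperates,
    fun f g => tendsto_resolvent_form hS hb hb_top hR ((sqrtOp L).mem_graph f)
      ((sqrtOp L).mem_graph g)⟩

variable [SigmaFinite μ]

theorem IsDirichlet.form_truncation_le (h : IsDirichlet L) {f g : (sqrtOp L).domain} {k : ℝ}
    (hk : 0 ≤ k) (hg : (g : Lp ℝ 2 μ) =ᵐ[μ] fun x => max (-k) (min ((f : Lp ℝ 2 μ) x) k)) :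
    form L g g ≤ form L f f := by
  obtain ⟨b, A, hb, hA, hlim⟩ := h.exists_isSubMarkov_tendsto_form
  exact le_of_tendsto_of_tendsto' (hlim g g) (hlim f f) fun n =>
    mul_le_mul_of_nonneg_left ((hA n).inner_truncation_le hk hg) (hb n).le

theorem IsDirichlet.form_sub_half_form_sq_le (h : IsDirichlet L)
    {f u v p : (sqrtOp L).domain} {c : ℝ} (hc : 0 ≤ c)
    (hu : (u : Lp ℝ 2 μ) =ᵐ[μ] fun x => (f : Lp ℝ 2 μ) x * (p : Lp ℝ 2 μ) x)
    (hv : (v : Lp ℝ 2 μ) =ᵐ[μ] fun x => ((f : Lp ℝ 2 μ) x) ^ 2)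
    (hp : ∀ᵐ x ∂μ, (p : Lp ℝ 2 μ) x ≤ c) :
    form L f u - 2⁻¹ * form L v p ≤ c * form L f f := by
  obtain ⟨b, A, hb, hA, hlim⟩ := h.exists_isSubMarkov_tendsto_form
  refine le_of_tendsto_of_tendsto' ((hlim f u).sub ((hlim v p).const_mul 2⁻¹))
    ((hlim f f).const_mul c) fun n => ?_
  linarith [mul_le_mul_of_nonneg_left ((hA n).inner_sub_half_inner_le hc hu hv hp) (hb n).le]

end Form

variable {X : Type*} [MetricSpace X] [MeasurableSpace X] {μ : Measure X}
  {L : Lp ℝ 2 μ →ₗ.[ℝ] Lp ℝ 2 μ} {m : Measure X}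

theorem isFiniteMeasure_energyMeasure (f : Lp ℝ 2 μ) : IsFiniteMeasure (energyMeasure L f) := by
  unfold energyMeasure
  split_ifs with h
  · exact h.choose_spec.2.1
  · infer_instance

variable [BorelSpace X] [SigmaFinite μ] {f : (sqrtOp L).domain}

theorem IsBddEnergyMeasure.integral_le (hm : IsBddEnergyMeasure L f m) (hDir : IsDirichlet L)
    (hReg : IsRegular L) {ψ : X → ℝ} {c : ℝ} (hψ : Continuous ψ) (hψ_supp : HasCompactSupport ψ)
    (hc : 0 ≤ c) (hψc : ∀ x, ψ x ≤ c) : ∫ x, ψ x ∂m ≤ c * form L f f := by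
  have := hm.1
  have hψ_int : Integrable ψ m := hψ.integrable_of_hasCompactSupport hψ_supp
  have happrox : ∀ δ > 0, ∫ x, ψ x ∂m ≤ (c + δ) * form L f f + δ * m.real Set.univ := by
    intro δ hδ
    obtain ⟨φ, p, hφ, hφ_supp, hpφ, hψφ⟩ := hReg.dense_continuous ψ hψ hψ_supp δ hδ
    have hφ_int : Integrable φ m := hφ.integrable_of_hasCompactSupport hφ_supp
    obtain ⟨u, v, hu, hv, hφm⟩ := hm.2 φ p hφ hφ_supp hpφ
    have hfp : (u : Lp ℝ 2 μ) =ᵐ[μ] fun x => (f : Lp ℝ 2 μ) x * (p : Lp ℝ 2 μ) x := by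
      filter_upwards [hu, hpφ] with x hux hpx
      rw [hux, hpx]
    have hpc : ∀ᵐ x ∂μ, (p : Lp ℝ 2 μ) x ≤ c + δ := by
      filter_upwards [hpφ] with x hpx
      linarith [(abs_lt.1 (hψφ x)).1, hψc x]
    calc ∫ x, ψ x ∂m ≤ ∫ x, (φ x + δ) ∂m :=
          integral_mono hψ_int (hφ_int.add (integrable_const δ)) fun x => by
            linarith [(abs_lt.1 (hψφ x)).2]
      _ = form L f u - 2⁻¹ * form L v p + δ * m.real Set.univ := by
          rw [integral_add hφ_int (integrable_const δ), hφm, integral_const, smul_eq_mul,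
            mul_comm δ, one_div]
      _ ≤ (c + δ) * form L f f + δ * m.real Set.univ := by
          linarith [hDir.form_sub_half_form_sq_le (by positivity) hfp hv hpc]
  have hlim : Tendsto (fun δ => (c + δ) * form L f f + δ * m.real Set.univ) (𝓝[>] 0)
      (𝓝 ((c + 0) * form L f f + 0 * m.real Set.univ)) :=
    (Continuous.tendsto (by fun_prop) 0).mono_left nhdsWithin_le_nhds
  rw [add_zero, zero_mul, add_zero] at hlim
  exact ge_of_tendsto hlim (eventually_mem_nhdsWithin.mono happrox)

variable [LocallyCompactSpace X]

theorem IsBddEnergyMeasure.measureReal_le_of_isCompact (hm : IsBddEnergyMeasure L f m)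
    (hDir : IsDirichlet L) (hReg : IsRegular L) {K : Set X} (hK : IsCompact K) :
    m.real K ≤ form L f f := by
  have := hm.1
  obtain ⟨ψ, hψ_one, -, hψ_supp, hψ⟩ :=
    exists_continuous_one_zero_of_isCompact hK isClosed_empty (Set.disjoint_empty K)
  calc m.real K = ∫ x in K, ψ x ∂m := by
        rw [setIntegral_congr_fun hK.measurableSet hψ_one]
        simp
    _ ≤ ∫ x, ψ x ∂m := setIntegral_le_integral
        (ψ.continuous.integrable_of_hasCompactSupport hψ_supp) (ae_of_all _ fun x => (hψ x).1)
    _ ≤ 1 * form L f f :=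
        hm.integral_le hDir hReg ψ.continuous hψ_supp zero_le_one fun x => (hψ x).2
    _ = form L f f := one_mul _

variable [TopologicalSpace.SeparableSpace X]

theorem IsBddEnergyMeasure.measure_univ_le (hm : IsBddEnergyMeasure L f m) (hDir : IsDirichlet L)
    (hReg : IsRegular L) : m Set.univ ≤ ENNReal.ofReal (form L f f) := by
  have := hm.1
  have := UniformSpace.secondCountable_of_separable X
  rw [isOpen_univ.measure_eq_iSup_isCompact]
  refine iSup₂_le fun K _ => iSup_le fun hK => ?_
  rw [← ofReal_measureReal]
  exact ENNReal.ofReal_le_ofReal (hm.measureReal_le_of_isCompact hDir hReg hK)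

theorem IsEnergyMeasure.measureReal_univ_le (hm : IsEnergyMeasure L f m) (hDir : IsDirichlet L)
    (hReg : IsRegular L) : m.real Set.univ ≤ form L f f := by
  obtain ⟨-, -, g, ν, hgν, hlim⟩ := hm
  refine ENNReal.toReal_le_of_le_ofReal (form_self_nonneg f)
    (le_of_tendsto' (hlim Set.univ MeasurableSet.univ) fun n => ?_)
  exact ((hgν n).2.measure_univ_le hDir hReg).trans
    (ENNReal.ofReal_le_ofReal (hDir.form_truncation_le n.cast_nonneg (hgν n).1))

theorem energyMeasure_real_univ_le (hDir : IsDirichlet L) (hReg : IsRegular L)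
    (f : (sqrtOp L).domain) : (energyMeasure L f).real Set.univ ≤ form L f f := by
  unfold energyMeasure
  split_ifs with h
  · exact h.choose_spec.measureReal_univ_le hDir hReg
  · simpa using form_self_nonneg f

end Energy

section Coefficients

theorem continuous_tsum_sq_inner {H ι : Type*} [NormedAddCommGroup H] [InnerProductSpace ℝ H]
    {e : ι → H} {K : ℝ} (hsum : ∀ f, Summable fun i => inner ℝ f (e i) ^ 2)
    (hle : ∀ f, ∑' i, inner ℝ f (e i) ^ 2 ≤ K * ‖f‖ ^ 2) :
    Continuous fun f => ∑' i, inner ℝ f (e i) ^ 2 := by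
  have hmem : ∀ f, Memℓp (fun i => inner ℝ f (e i)) 2 := fun f =>
    memℓp_gen (by simpa using hsum f)
  let T : H →ₗ[ℝ] lp (fun _ : ι => ℝ) 2 :=
    { toFun := fun f => ⟨fun i => inner ℝ f (e i), hmem f⟩
      map_add' := fun f g => lp.ext (funext fun i => inner_add_left f g (e i))
      map_smul' := fun c f => lp.ext (funext fun i => real_inner_smul_left f (e i) c) }
  have hT : ∀ f, ‖T f‖ ^ 2 = ∑' i, inner ℝ f (e i) ^ 2 := fun f => by
    simpa [T] using lp.norm_rpow_eq_tsum (by norm_num) (T f)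
  have hTcont : Continuous T := (T.mkContinuous (√K) fun f => by
    rw [← Real.sqrt_sq (norm_nonneg f), ← Real.sqrt_mul' _ (sq_nonneg _)]
    exact Real.le_sqrt_of_sq_le ((hT f).trans_le (hle f))).continuous
  simp_rw [← hT]
  fun_prop

theorem integral_sq_eq_integral_sub_average_sq_add {Y : Type*} [MeasurableSpace Y]
    {ν : Measure Y} [IsFiniteMeasure ν] {f : Y → ℝ} (hf : MemLp f 2 ν) :
    ∫ y, f y ^ 2 ∂ν =
      ∫ y, (f y - ⨍ z, f z ∂ν) ^ 2 ∂ν + ν.real Set.univ * (⨍ y, f y ∂ν) ^ 2 := by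
  set a := ⨍ y, f y ∂ν
  have hmean : ν.real Set.univ * a = ∫ y, f y ∂ν := measure_smul_average ν f
  have hcross : Integrable (fun y => 2 * a * f y) ν := (hf.integrable one_le_two).const_mul _
  have hexpand : ∀ y, (f y - a) ^ 2 = f y ^ 2 - 2 * a * f y + a ^ 2 := fun y => by ring
  have hsub : Integrable (fun y => f y ^ 2 - 2 * a * f y) ν := hf.integrable_sq.sub hcross
  simp_rw [hexpand]
  rw [integral_add hsub (integrable_const _), integral_sub hf.integrable_sq hcross,
    integral_const_mul, integral_const, smul_eq_mul, ← hmean]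
  ring

variable {X : Type*} [MetricSpace X] [MeasurableSpace X] [OpensMeasurableSpace X]
  {μ : Measure X} {p : X} {ρ : ℝ}

theorem memLp_xi (hfin : μ (ball p ρ) ≠ ∞) : MemLp (xi μ ρ p) 2 μ :=
  memLp_indicator_const 2 measurableSet_ball _ (Or.inr hfin)

theorem inner_toLp_xi (f : Lp ℝ 2 μ) (hfin : μ (ball p ρ) ≠ ∞) :
    inner ℝ f ((memLp_xi hfin).toLp _) = ∫ x, f x * xi μ ρ p x ∂μ := by
  rw [inner_eq_integral_mul]
  refine integral_congr_ae ?_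
  filter_upwards [(memLp_xi hfin).coeFn_toLp] with x hx
  rw [hx]

theorem integral_mul_xi (f : X → ℝ) :
    ∫ x, f x * xi μ ρ p x ∂μ = μ.real (ball p ρ) ^ (-(1 / 2) : ℝ) * ∫ x in ball p ρ, f x ∂μ := by
  simp_rw [xi, ← Set.indicator_mul_right (ball p ρ) f]
  rw [integral_indicator measurableSet_ball, integral_mul_const, mul_comm]

theorem sq_integral_mul_xi (hpos : 0 < μ.real (ball p ρ)) (f : X → ℝ) :
    (∫ x, f x * xi μ ρ p x ∂μ) ^ 2
      = μ.real (ball p ρ) * (⨍ x in ball p ρ, f x ∂μ) ^ 2 := by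
  have hrpow : (μ.real (ball p ρ) ^ (-(1 / 2) : ℝ)) ^ 2 = (μ.real (ball p ρ))⁻¹ := by
    rw [← Real.rpow_mul_natCast hpos.le, ← Real.rpow_neg_one]
    norm_num
  rw [integral_mul_xi, mul_pow, hrpow, setAverage_eq, smul_eq_mul]
  field_simp

theorem setIntegral_sq_eq (f : Lp ℝ 2 μ) (hpos : 0 < μ.real (ball p ρ)) :
    ∫ x in ball p ρ, f x ^ 2 ∂μ =
      ∫ y in ball p ρ, (f y - ⨍ z in ball p ρ, f z ∂μ) ^ 2 ∂μ
        + (∫ x, f x * xi μ ρ p x ∂μ) ^ 2 := by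
  have : IsFiniteMeasure (μ.restrict (ball p ρ)) :=
    isFiniteMeasure_restrict.2 fun htop => hpos.ne' (by simp [measureReal_def, htop])
  rw [integral_sq_eq_integral_sub_average_sq_add ((Lp.memLp f).restrict _),
    sq_integral_mul_xi hpos, measureReal_restrict_apply_univ]

end Coefficients

section Global

variable {X : Type*} [MetricSpace X] [MeasurableSpace X] {μ : Measure X}
  [IsLocallyFiniteMeasure μ] {D ρ : ℝ} {N : ℕ} {Λ : Set X}

section Bessel

variable [OpensMeasurableSpace X]

theorem IsDoubling.sq_integral_mul_xi_le (h : IsDoubling μ D) (hρ : 0 < ρ) (f : Lp ℝ 2 μ)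
    (p : X) : (∫ x, f x * xi μ ρ p x ∂μ) ^ 2 ≤ ∫ x in ball p ρ, f x ^ 2 ∂μ := by
  rw [setIntegral_sq_eq f (h.measureReal_ball_pos p hρ)]
  exact le_add_of_nonneg_left (integral_nonneg fun _ => sq_nonneg _)

variable [TopologicalSpace.SeparableSpace X]

theorem IsLattice.summable_sq_integral_mul_xi (hΛ : IsLattice N ρ Λ) (h : IsDoubling μ D)
    (hρ : 0 < ρ) (f : Lp ℝ 2 μ) :
    Summable fun p : Λ => (∫ x, f x * xi μ ρ p x ∂μ) ^ 2 :=
  (hΛ.hasSum_setIntegral hρ (Lp.memLp f).integrable_sq).summable.of_nonneg_of_le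
    (fun _ => sq_nonneg _) fun p => h.sq_integral_mul_xi_le hρ f p

theorem IsLattice.tsum_sq_integral_mul_xi_le (hΛ : IsLattice N ρ Λ) (h : IsDoubling μ D)
    (hρ : 0 < ρ) (f : Lp ℝ 2 μ) :
    ∑' p : Λ, (∫ x, f x * xi μ ρ p x ∂μ) ^ 2 ≤ N * ‖f‖ ^ 2 := by
  have hf := (Lp.memLp f).integrable_sq
  rw [norm_sq_eq_integral_sq]
  calc ∑' p : Λ, (∫ x, f x * xi μ ρ p x ∂μ) ^ 2 ≤ ∑' p : Λ, ∫ x in ball p ρ, f x ^ 2 ∂μ :=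
        Summable.tsum_le_tsum (fun p => h.sq_integral_mul_xi_le hρ f p)
          (hΛ.summable_sq_integral_mul_xi h hρ f) (hΛ.hasSum_setIntegral hρ hf).summable
    _ ≤ N * ∫ x, f x ^ 2 ∂μ := hΛ.tsum_setIntegral_le hρ hf fun _ => sq_nonneg _

theorem IsLattice.continuous_tsum_sq_integral_mul_xi (hΛ : IsLattice N ρ Λ)
    (h : IsDoubling μ D) (hρ : 0 < ρ) :
    Continuous fun f : Lp ℝ 2 μ => ∑' p : Λ, (∫ x, f x * xi μ ρ p x ∂μ) ^ 2 := by
  have hinner := fun (f : Lp ℝ 2 μ) (p : Λ) =>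
    inner_toLp_xi f (h.measure_ball_lt_top (p : X) ρ).ne
  have hsum := hΛ.summable_sq_integral_mul_xi h hρ
  have hle := hΛ.tsum_sq_integral_mul_xi_le h hρ
  simp_rw [← hinner] at hsum hle ⊢
  exact continuous_tsum_sq_inner hsum hle

end Bessel

variable [TopologicalSpace.SeparableSpace X] [LocallyCompactSpace X] [BorelSpace X]
  {L : Lp ℝ 2 μ →ₗ.[ℝ] Lp ℝ 2 μ} {C r₀ : ℝ}

theorem IsLattice.norm_sq_le_of_mem_domain (hΛ : IsLattice N ρ Λ) (h : IsDoubling μ D)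
    (hDir : IsDirichlet L) (hReg : IsRegular L) (hC : 0 ≤ C) (hP : LocalPoincare L C r₀)
    (hρ : 0 < ρ) (hρr : ρ < r₀) (f : (sqrtOp L).domain) (hf : (f : Lp ℝ 2 μ) ∈ L.domain) :
    ‖(f : Lp ℝ 2 μ)‖ ^ 2 ≤ C * N * ρ ^ 2 * form L f f +
      ∑' p : Λ, (∫ x, (f : Lp ℝ 2 μ) x * xi μ ρ p x ∂μ) ^ 2 := by
  have := UniformSpace.secondCountable_of_separable X
  have := isFiniteMeasure_energyMeasure (L := L) (f : Lp ℝ 2 μ)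
  have hΓ := hΛ.summable_measureReal hρ (energyMeasure L f)
  have hΓ_le : ∑' p : Λ, (energyMeasure L f).real (ball p ρ) ≤ N * form L f f :=
    (hΛ.tsum_measureReal_le hρ _).trans (by gcongr; exact energyMeasure_real_univ_le hDir hReg f)
  have hcoeff := hΛ.summable_sq_integral_mul_xi h hρ (f : Lp ℝ 2 μ)
  have hint := (Lp.memLp (f : Lp ℝ 2 μ)).integrable_sq
  have hball : ∀ p : Λ, ∫ x in ball p ρ, (f : Lp ℝ 2 μ) x ^ 2 ∂μ
      ≤ C * ρ ^ 2 * (energyMeasure L f).real (ball p ρ)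
        + (∫ x, (f : Lp ℝ 2 μ) x * xi μ ρ p x ∂μ) ^ 2 := fun p => by
    rw [setIntegral_sq_eq _ (h.measureReal_ball_pos (p : X) hρ)]
    gcongr
    exact hP f hf p ρ hρ hρr
  calc ‖(f : Lp ℝ 2 μ)‖ ^ 2 = ∫ x, (f : Lp ℝ 2 μ) x ^ 2 ∂μ := norm_sq_eq_integral_sq _
    _ ≤ ∑' p : Λ, ∫ x in ball p ρ, (f : Lp ℝ 2 μ) x ^ 2 ∂μ :=
        hΛ.integral_le_tsum hρ hint fun _ => sq_nonneg _
    _ ≤ ∑' p : Λ, (C * ρ ^ 2 * (energyMeasure L f).real (ball p ρ)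
          + (∫ x, (f : Lp ℝ 2 μ) x * xi μ ρ p x ∂μ) ^ 2) :=
        (hΛ.hasSum_setIntegral hρ hint).summable.tsum_le_tsum hball
          ((hΓ.mul_left _).add hcoeff)
    _ = C * ρ ^ 2 * ∑' p : Λ, (energyMeasure L f).real (ball p ρ)
          + ∑' p : Λ, (∫ x, (f : Lp ℝ 2 μ) x * xi μ ρ p x ∂μ) ^ 2 := by
        rw [(hΓ.mul_left _).tsum_add hcoeff, tsum_mul_left]
    _ ≤ C * ρ ^ 2 * (N * form L f f)
          + ∑' p : Λ, (∫ x, (f : Lp ℝ 2 μ) x * xi μ ρ p x ∂μ) ^ 2 := by gcongr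
    _ = C * N * ρ ^ 2 * form L f f
          + ∑' p : Λ, (∫ x, (f : Lp ℝ 2 μ) x * xi μ ρ p x ∂μ) ^ 2 := by ring

theorem IsLattice.norm_sq_le (hΛ : IsLattice N ρ Λ) (h : IsDoubling μ D) (hL : IsSelfAdjoint L)
    (hDir : IsDirichlet L) (hReg : IsRegular L) (hC : 0 ≤ C) (hP : LocalPoincare L C r₀)
    (hρ : 0 < ρ) (hρr : ρ < r₀) (f : (sqrtOp L).domain) :
    ‖(f : Lp ℝ 2 μ)‖ ^ 2 ≤ C * N * ρ ^ 2 * ‖sqrtOp L f‖ ^ 2 +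
      ∑' p : Λ, (∫ x, (f : Lp ℝ 2 μ) x * xi μ ρ p x ∂μ) ^ 2 := by
  obtain ⟨g, g', hg, hlim, hlim'⟩ := exists_seq_mem_domain_tendsto hL ((sqrtOp L).mem_graph f)
  refine le_of_tendsto_of_tendsto' (hlim.norm.pow 2) (((hlim'.norm.pow 2).const_mul _).add
    (((hΛ.continuous_tsum_sq_integral_mul_xi h hρ).tendsto _).comp hlim)) fun n => ?_
  have hdom := LinearPMap.mem_domain_of_mem_graph (hg n).2
  have hle := hΛ.norm_sq_le_of_mem_domain h hDir hReg hC hP hρ hρr ⟨g n, hdom⟩ (hg n).1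
  rwa [form_self, ← (LinearPMap.image_iff hdom).2 (hg n).2] at hle

end Global

theorem add_le_one_add_mul_add {a q α : ℝ} (ha : 0 ≤ a) (hq : 0 ≤ q) (hα : 0 < α) :
    a + q ≤ (1 + α) * a + (1 + α) / α * q := by
  have hone : 1 ≤ (1 + α) / α := (one_le_div hα).2 (by linarith)
  linarith [mul_nonneg hα.le ha, le_mul_of_one_le_left hq hone]

end GlobalPoincare

theorem mainTheorem3_general {X : Type*} [MetricSpace X] [LocallyCompactSpace X]
    [TopologicalSpace.SeparableSpace X] [MeasurableSpace X] [BorelSpace X]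
    (μ : Measure X) [IsLocallyFiniteMeasure μ] (D : ℝ) (hdoubling : GlobalPoincare.IsDoubling μ D)
    (L : Lp ℝ 2 μ →ₗ.[ℝ] Lp ℝ 2 μ) (hL : IsSelfAdjoint L) (_hL0 : GlobalPoincare.IsNonneg L)
    (hDir : GlobalPoincare.IsDirichlet L) (hReg : GlobalPoincare.IsRegular L)
    (C r₀ : ℝ) (hC : 0 ≤ C) (hP : GlobalPoincare.LocalPoincare L C r₀) :
    (∃ N : ℕ, (N : ℝ) ≤ (8 : ℝ) ^ D ∧
      ∀ ρ : ℝ, 0 < ρ → ∃ Λ : Set X, GlobalPoincare.IsLattice N ρ Λ) ∧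
    ∀ (N : ℕ) (ρ : ℝ) (Λ : Set X), 0 < ρ → ρ < r₀ → GlobalPoincare.IsLattice N ρ Λ →
      ∀ f : (GlobalPoincare.sqrtOp L).domain,
        Summable (fun p : Λ =>
          |∫ x, (f : Lp ℝ 2 μ) x * GlobalPoincare.xi μ ρ (p : X) x ∂μ| ^ 2) ∧
        ‖(f : Lp ℝ 2 μ)‖ ^ 2 ≤
          C * N * ρ ^ 2 * ‖GlobalPoincare.sqrtOp L f‖ ^ 2 +
            ∑' p : Λ, |∫ x, (f : Lp ℝ 2 μ) x * GlobalPoincare.xi μ ρ (p : X) x ∂μ| ^ 2 := by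
  simp only [sq_abs]
  exact ⟨⟨⌊(8 : ℝ) ^ D⌋₊, Nat.floor_le (by positivity), fun _ => hdoubling.exists_isLattice⟩,
    fun _ _ _ hρ hρr hΛ f => ⟨hΛ.summable_sq_integral_mul_xi hdoubling hρ f,
      hΛ.norm_sq_le hdoubling hL hDir hReg hC hP hρ hρr f⟩⟩

theorem mainTheorem3 {X : Type*} [MetricSpace X] [LocallyCompactSpace X]
    [TopologicalSpace.SeparableSpace X] [MeasurableSpace X] [BorelSpace X]
    (μ : Measure X) [μ.Regular] (D : ℝ) (hD : 0 < D) (hdoubling : GlobalPoincare.IsDoubling μ D)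
    (L : Lp ℝ 2 μ →ₗ.[ℝ] Lp ℝ 2 μ) (hL : IsSelfAdjoint L) (hL0 : GlobalPoincare.IsNonneg L)
    (hDir : GlobalPoincare.IsDirichlet L) (hReg : GlobalPoincare.IsRegular L)
    (hLoc : GlobalPoincare.IsStronglyLocal L)
    (C r₀ : ℝ) (hC : 0 < C) (hr₀ : 0 < r₀) (hP : GlobalPoincare.LocalPoincare L C r₀) :
    (∃ N : ℕ, (N : ℝ) ≤ (80 : ℝ) ^ D ∧
      ∀ ρ : ℝ, 0 < ρ → ∃ Λ : Set X, GlobalPoincare.IsLattice N ρ Λ) ∧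
    ∀ (N : ℕ) (ρ : ℝ) (Λ : Set X), 0 < ρ → ρ < r₀ → GlobalPoincare.IsLattice N ρ Λ →
      ∀ f : (GlobalPoincare.sqrtOp L).domain, ∀ α : ℝ, 0 < α →
        Summable (fun p : Λ =>
          |∫ x, (f : Lp ℝ 2 μ) x * GlobalPoincare.xi μ ρ (p : X) x ∂μ| ^ 2) ∧
        ‖(f : Lp ℝ 2 μ)‖ ^ 2 ≤
          (1 + α) * C * N * ρ ^ 2 * ‖GlobalPoincare.sqrtOp L f‖ ^ 2 +
          (1 + α) / α *
            ∑' p : Λ, |∫ x, (f : Lp ℝ 2 μ) x * GlobalPoincare.xi μ ρ (p : X) x ∂μ| ^ 2 := by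
  obtain ⟨⟨N, hN, hΛ⟩, h⟩ := mainTheorem3_general μ D hdoubling L hL hL0 hDir hReg C r₀ hC.le hP
  exact ⟨⟨N, hN.trans (Real.rpow_le_rpow (by norm_num) (by norm_num) hD.le), hΛ⟩,
    fun N ρ Λ hρ hρr hΛ f α hα => (h N ρ Λ hρ hρr hΛ f).imp_right fun hf => hf.trans <| by
      simpa only [mul_assoc] using GlobalPoincare.add_le_one_add_mul_add (by positivity)
        (tsum_nonneg fun _ => sq_nonneg _) hα⟩
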